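/- The following is a theorem of Zermelo--Fraenkel set theory $\mathsf{ZF}$ (without the axiom of choice); that is, it holds in every model of $\mathsf{ZF}$. Write $|A|\le|B|$ if there is an injective function $A\to B$, $|A|=|B|$ if there is a bijection $A\to B$, and $|A|<|B|$ if $|A|\le|B|$ and $|A|\ne|B|$. Let $X$ be a Russell set: $X=\bigcup_{n\in\mathbb N}P_n$, where the $P_n$ are pairwise disjoint sets with exactly two elements each, and no infinite subset of the family $\{P_n : n\in\mathbb N\}$ has a choice function. Let $G=(X,E)$ be the graph with vertex set $X$ and edge set $E=\{P_n : n\in\mathbb N\}$. For a set $A$ (of colours), a proper coloring of $G$ with colours in $A$ is a function $c:X\to A$ such that $c(u)\neq c(v)$ whenever $\{u,v\}\in E$. Then $G$ has no well-defined chromatic number: there is no set $A$ such that $G$ has a proper coloring with colours in $A$ and $|A|\le|B|$ for every set $B$ such that $G$ has a proper coloring with colours in $B$. In fact, for every set $A$ and every proper coloring $c:X\to A$ of $G$ there are a set $B$ with $|B|<|A|$ and a proper coloring $d:X\to B$ of $G$. -/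

import Mathlib

namespace ZFModel

universe u

/-- The only non-logical symbol of the language of set theory: a binary relation symbol. -/
inductive MemSymbol : ℕ → Type
  | mem : MemSymbol 2

/-- The first-order language of set theory. -/
def setLang : FirstOrder.Language := ⟨fun _ => Empty, MemSymbol⟩

section

variable {M : Type u} [setLang.Structure M]

/-- The membership relation of a structure for the language of set theory. It has nothing to do
with the metatheoretic membership `∈`. -/
def Mem (x y : M) : Prop :=
  FirstOrder.Language.Structure.RelMap (L := setLang) MemSymbol.mem ![x, y]

infix:50 " ∊ " => Mem

/-! ### Basic set-theoretic notions, interpreted inside the structure -/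

/-- `e = ∅`. -/
def IsEmptySet (e : M) : Prop := ∀ x, ¬ x ∊ e

/-- `a ⊆ b`. -/
def Sub (a b : M) : Prop := ∀ x, x ∊ a → x ∊ b

/-- `z = {x, y}`. -/
def IsUnorderedPair (z x y : M) : Prop := ∀ w, w ∊ z ↔ w = x ∨ w = y

/-- `s = x ∪ {x}`. -/
def IsSucc (s x : M) : Prop := ∀ w, w ∊ s ↔ w ∊ x ∨ w = x

/-- `p = (x, y) = {{x}, {x, y}}`, the Kuratowski pair. -/
def IsOrderedPair (p x y : M) : Prop :=
  ∃ a b, IsUnorderedPair a x x ∧ IsUnorderedPair b x y ∧ IsUnorderedPair p a b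

/-- `∅ ∈ w`, and `w` is closed under `x ↦ x ∪ {x}`. -/
def IsInductive (w : M) : Prop :=
  (∃ e, IsEmptySet e ∧ e ∊ w) ∧ ∀ x, x ∊ w → ∃ s, IsSucc s x ∧ s ∊ w

/-- `w` is the set of natural numbers: the least inductive set. -/
def IsOmega (w : M) : Prop := IsInductive w ∧ ∀ v, IsInductive v → Sub w v

end

/-- The structure `M` is a model of Zermelo-Fraenkel set theory, without the axiom of choice.
Both schemata range over the formulas of the language of set theory with parameters in `M`. -/
structure IsModelZF (M : Type u) [setLang.Structure M] : Prop where
  extensionality : ∀ a b : M, (∀ x, x ∊ a ↔ x ∊ b) → a = b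
  foundation : ∀ a : M, (∃ x, x ∊ a) → ∃ x, x ∊ a ∧ ∀ y, y ∊ x → ¬ y ∊ a
  pairing : ∀ x y : M, ∃ z, IsUnorderedPair z x y
  union : ∀ a : M, ∃ b, ∀ x, x ∊ b ↔ ∃ y, y ∊ a ∧ x ∊ y
  powerset : ∀ a : M, ∃ b, ∀ x, x ∊ b ↔ Sub x a
  infinity : ∃ w : M, IsInductive w
  separation : ∀ S : Set M, (Set.univ : Set M).Definable₁ setLang S →
    ∀ a : M, ∃ b, ∀ x, x ∊ b ↔ x ∊ a ∧ x ∈ S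
  replacement : ∀ R : Set (M × M), (Set.univ : Set M).Definable₂ setLang R →
    ∀ a : M, (∀ x, x ∊ a → ∀ y z, (x, y) ∈ R → (x, z) ∈ R → y = z) →
      ∃ b, ∀ y, y ∊ b ↔ ∃ x, x ∊ a ∧ (x, y) ∈ R

section

variable {M : Type u} [setLang.Structure M]

/-! ### Functions and cardinalities, inside the structure -/

/-- `(x, y) ∈ f`; for a function `f` this says `f(x) = y`. -/
def Maps (f x y : M) : Prop := ∃ p, IsOrderedPair p x y ∧ p ∊ f

/-- `f` is a function from `a` to `b`. -/
def IsFunction (f a b : M) : Prop :=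
  (∀ p, p ∊ f → ∃ x y, x ∊ a ∧ y ∊ b ∧ IsOrderedPair p x y) ∧
    ∀ x, x ∊ a → ∃! y, Maps f x y

/-- `|a| ≤ |b|`: there is an injective function from `a` to `b`. -/
def CardLE (a b : M) : Prop :=
  ∃ f, IsFunction f a b ∧ ∀ x x' y, Maps f x y → Maps f x' y → x = x'

/-- `|a| = |b|`: there is a bijective function from `a` to `b`. -/
def CardEq (a b : M) : Prop :=
  ∃ f, IsFunction f a b ∧ (∀ x x' y, Maps f x y → Maps f x' y → x = x') ∧
    ∀ y, y ∊ b → ∃ x, Maps f x y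

/-- `|a| < |b|`. -/
def CardLT (a b : M) : Prop := CardLE a b ∧ ¬ CardEq a b

/-- `a` is finite: equipotent to a natural number. -/
def IsFinite (a : M) : Prop := ∃ w n, IsOmega w ∧ n ∊ w ∧ CardEq a n

/-- `s`, as a family of sets, has a choice function. -/
def HasChoiceFunction (s : M) : Prop :=
  ∃ f b, IsFunction f s b ∧ ∀ a x, a ∊ s → Maps f a x → x ∊ a

/-! ### Graphs and Russell sets, inside the structure -/

/-- `c : V → A` is a proper colouring, with `A` as set of colours, of the graph with vertex set
`V` and edge set `E` (a set of unordered pairs of vertices). -/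
def IsProperColoring (V E A c : M) : Prop :=
  IsFunction c V A ∧
    ∀ e u v, e ∊ E → IsUnorderedPair e u v → ∀ a b, Maps c u a → Maps c v b → a ≠ b

/-- The graph `(V, E)` has a proper colouring with `A` as set of colours. -/
def Colorable (V E A : M) : Prop := ∃ c, IsProperColoring V E A c

/-- The chromatic number of the graph `(V, E)` is `|A|`: this is the least cardinality of a set of
colours with which the graph has a proper colouring. -/
def IsChromaticNumber (V E A : M) : Prop :=
  Colorable V E A ∧ ∀ B, Colorable V E B → CardLE A B

/-- `X` is a Russell set, as witnessed by the sequence `P = (P_n)` indexed by the natural numbers: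
the `P_n` are pairwise disjoint sets with exactly two elements, their union is `X`, and no infinite
subset of `{P_n | n ∈ ω}` has a choice function. -/
structure IsRussellSet (X P : M) : Prop where
  sequence : ∃ w Q, IsOmega w ∧ IsFunction P w Q
  pair : ∀ n p, Maps P n p → ∃ x y, x ≠ y ∧ IsUnorderedPair p x y
  disjoint : ∀ m n p q, Maps P m p → Maps P n q → m ≠ n → ∀ x, ¬ (x ∊ p ∧ x ∊ q)
  cover : ∀ x, x ∊ X ↔ ∃ n p, Maps P n p ∧ x ∊ p
  no_choice : ∀ S, (∀ p, p ∊ S → ∃ n, Maps P n p) → ¬ IsFinite S → ¬ HasChoiceFunction S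

/-- `E = {P_n | n ∈ ω}` is the set of terms of the sequence `P`. -/
def IsSetOfTerms (E P : M) : Prop := ∀ e, e ∊ E ↔ ∃ n, Maps P n e

end

end ZFModel

/-!
Let `c` be a proper colouring with colours in `A` and let `a` be a colour that it uses. At least
three colours are used: if all the colours were `a` and `b`, picking the vertex of colour `a` would
be a choice function on all the edges. Hence `c` can be recoloured on the edges where `a` occurs,
with two other used colours, and the set `B` of the used colours other than `a` suffices.

If `h : A → B` were injective, then `a, h(a), h(h(a)), …` would be distinct used colours. Each edge
carries at most two of them, so infinitely many edges meet this orbit, and picking on each of these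
edges the vertex whose colour comes first in the orbit is a choice function. This is impossible,
so `|A| ≰ |B|`.
-/

namespace ZFModel

variable {M : Type*} [setLang.Structure M]

/-! ### Definability by instance inference -/

section Definability

open FirstOrder Language

/-- `t` is a function of its arguments that is definable with parameters, to be substituted for
the variables of definable predicates. In practice `t` is a variable or a parameter. -/
class DefinableTerm {α : Type} (t : (α → M) → M) : Prop where
  definableFun : Set.univ.DefinableFun setLang t

/-- `p` is definable with parameters, as the axiom schemata of `IsModelZF` require. This is a class
so that the definability of an explicit predicate is found by instance inference. -/
class DefinablePred {α : Type} (p : (α → M) → Prop) : Prop where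
  definable : Set.univ.Definable setLang {v | p v}

/-- `DefinablePred` for a subclass of `M`. -/
abbrev DefinablePred₁ (p : M → Prop) : Prop := DefinablePred fun v : Fin 1 → M => p (v 0)

/-- `DefinablePred` for a binary relation on `M`. -/
abbrev DefinablePred₂ (R : M → M → Prop) : Prop :=
  DefinablePred fun v : Fin 2 → M => R (v 0) (v 1)

variable {α β : Type}

instance DefinableTerm.var (i : α) : DefinableTerm fun v : α → M => v i :=
  ⟨Set.DefinableFun.proj setLang⟩

instance DefinableTerm.const (c : M) : DefinableTerm fun _ : α → M => c :=
  ⟨setLang.definableFun_const α (Set.mem_univ c)⟩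

instance DefinableTerm.rename (σ : α → β) (t : (α → M) → M) [ht : DefinableTerm t] :
    DefinableTerm fun w : β → M => t fun i => w (σ i) :=
  ⟨ht.definableFun.preimage_comp (Option.map σ)⟩

theorem DefinablePred₂.comp {R : M → M → Prop} (hR : DefinablePred₂ R) (s t : (α → M) → M)
    [hs : DefinableTerm s] [ht : DefinableTerm t] : DefinablePred fun v => R (s v) (t v) :=
  ⟨hR.definable.preimage_map (F := fun v => ![s v, t v])
    (by simpa [Set.DefinableMap] using ⟨hs.1, ht.1⟩)⟩

instance DefinablePred.mem (s t : (α → M) → M) [DefinableTerm s] [DefinableTerm t] :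
    DefinablePred fun v => s v ∊ t v := by
  have mem_definable : (∅ : Set M).Definable setLang {v : Fin 2 → M | v 0 ∊ v 1} := by
    rw [Set.empty_definable_iff]
    let r : setLang.Relations 2 := MemSymbol.mem
    refine ⟨r.formula₂ (Term.var 0) (Term.var 1), ?_⟩
    ext v
    change v 0 ∊ v 1 ↔ (r.formula₂ (Term.var 0) (Term.var 1)).Realize v
    rw [Formula.realize_rel₂]
    rfl
  exact DefinablePred₂.comp (R := Mem) ⟨mem_definable.mono (Set.empty_subset _)⟩ s t

instance DefinablePred.eq (s t : (α → M) → M) [hs : DefinableTerm s] [ht : DefinableTerm t] :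
    DefinablePred fun v => s v = t v :=
  ⟨hs.definableFun.ofPred_eq ht.definableFun⟩

variable (p q : (α → M) → Prop) [hp : DefinablePred p] [hq : DefinablePred q]

instance DefinablePred.not : DefinablePred fun v => ¬ p v :=
  ⟨hp.definable.compl⟩

instance DefinablePred.and : DefinablePred fun v => p v ∧ q v :=
  ⟨hp.definable.inter hq.definable⟩

instance DefinablePred.or : DefinablePred fun v => p v ∨ q v :=
  ⟨hp.definable.union hq.definable⟩

instance DefinablePred.imp : DefinablePred fun v => p v → q v := by
  simp only [imp_iff_not_or]
  infer_instance

instance DefinablePred.iff : DefinablePred fun v => p v ↔ q v := by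
  simp only [iff_def]
  infer_instance

omit hp hq

instance DefinablePred.exists (r : (α → M) → M → Prop)
    [hr : DefinablePred fun w : α ⊕ Unit → M => r (fun i => w (Sum.inl i)) (w (Sum.inr ()))] :
    DefinablePred fun v => ∃ x, r v x := by
  refine ⟨?_⟩
  convert! hr.definable.exists_of_finite using 1
  ext v
  exact ⟨fun ⟨x, hx⟩ => ⟨fun _ => x, hx⟩, fun ⟨u, hu⟩ => ⟨u (), hu⟩⟩

instance DefinablePred.forall (r : (α → M) → M → Prop)
    [hr : DefinablePred fun w : α ⊕ Unit → M => r (fun i => w (Sum.inl i)) (w (Sum.inr ()))] :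
    DefinablePred fun v => ∀ x, r v x := by
  refine ⟨?_⟩
  convert! hr.definable.forall_of_finite using 1
  ext v
  exact ⟨fun h u => h (u ()), fun h x => h fun _ => x⟩

variable (r s t : (α → M) → M) [DefinableTerm r] [DefinableTerm s] [DefinableTerm t]

instance DefinablePred.isSucc : DefinablePred fun v => IsSucc (s v) (t v) := by
  unfold IsSucc
  infer_instance

instance DefinablePred.isOrderedPair : DefinablePred fun v => IsOrderedPair (r v) (s v) (t v) := by
  unfold IsOrderedPair IsUnorderedPair
  infer_instance

instance DefinablePred.maps : DefinablePred fun v => Maps (r v) (s v) (t v) := by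
  unfold Maps
  infer_instance

end Definability

/-! ### Pairs, functions and cardinalities -/

theorem IsUnorderedPair.left_mem {z x y : M} (h : IsUnorderedPair z x y) : x ∊ z :=
  (h x).2 (Or.inl rfl)

theorem IsUnorderedPair.right_mem {z x y : M} (h : IsUnorderedPair z x y) : y ∊ z :=
  (h y).2 (Or.inr rfl)

theorem IsUnorderedPair.eq_and_eq_or {z x y x' y' : M} (h : IsUnorderedPair z x y)
    (h' : IsUnorderedPair z x' y') : x = x' ∧ y = y' ∨ x = y' ∧ y = x' := by
  have hx := (h' x).1 h.left_mem
  have hy := (h' y).1 h.right_mem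
  have hx' := (h x').1 h'.left_mem
  have hy' := (h y').1 h'.right_mem
  grind

theorem IsUnorderedPair.of_mem_of_ne {z x y u v : M} (h : IsUnorderedPair z x y) (hu : u ∊ z)
    (hv : v ∊ z) (huv : u ≠ v) : IsUnorderedPair z u v := by
  have hu := (h u).1 hu
  have hv := (h v).1 hv
  intro w
  rw [h w]
  grind

theorem IsOrderedPair.injective {p x y x' y' : M} (h : IsOrderedPair p x y)
    (h' : IsOrderedPair p x' y') : x = x' ∧ y = y' := by
  obtain ⟨a, b, ha, hb, hp⟩ := h
  obtain ⟨a', b', ha', hb', hp'⟩ := h'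
  rcases hp.eq_and_eq_or hp' with ⟨rfl, rfl⟩ | ⟨rfl, rfl⟩
  · have hx := ha.eq_and_eq_or ha'
    have hy := hb.eq_and_eq_or hb'
    grind
  · have hx := ha.eq_and_eq_or hb'
    have hy := hb.eq_and_eq_or ha'
    grind

theorem IsFunction.mem_of_maps {f a b x y : M} (hf : IsFunction f a b) (h : Maps f x y) :
    x ∊ a ∧ y ∊ b := by
  obtain ⟨p, hp, hpf⟩ := h
  obtain ⟨x', y', hx, hy, hp'⟩ := hf.1 p hpf
  obtain ⟨rfl, rfl⟩ := hp.injective hp'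
  exact ⟨hx, hy⟩

theorem IsFunction.maps_unique {f a b x y z : M} (hf : IsFunction f a b) (hy : Maps f x y)
    (hz : Maps f x z) : y = z :=
  (hf.2 x (hf.mem_of_maps hy).1).unique hy hz

theorem IsFunction.mono {f a b c : M} (hf : IsFunction f a b) (hbc : Sub b c) :
    IsFunction f a c := by
  refine ⟨fun p hp => ?_, hf.2⟩
  obtain ⟨x, y, hx, hy, hxy⟩ := hf.1 p hp
  exact ⟨x, y, hx, hbc y hy, hxy⟩

namespace IsModelZF

variable (hM : IsModelZF M)
include hM

theorem exists_separation (p : M → Prop) [hp : DefinablePred₁ p] (a : M) :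
    ∃ b, ∀ x, x ∊ b ↔ x ∊ a ∧ p x :=
  hM.separation {x | p x} hp.definable a

theorem exists_union (a b : M) : ∃ c, ∀ x, x ∊ c ↔ x ∊ a ∨ x ∊ b := by
  obtain ⟨z, hz⟩ := hM.pairing a b
  obtain ⟨c, hc⟩ := hM.union z
  refine ⟨c, fun x => (hc x).trans ⟨?_, ?_⟩⟩
  · rintro ⟨y, hy, hx⟩
    rcases (hz y).1 hy with rfl | rfl
    exacts [Or.inl hx, Or.inr hx]
  · rintro (h | h)
    exacts [⟨a, hz.left_mem, h⟩, ⟨b, hz.right_mem, h⟩]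

theorem not_mem_of_mem {x y : M} (hxy : x ∊ y) : ¬ y ∊ x := by
  intro hyx
  obtain ⟨z, hz⟩ := hM.pairing x y
  obtain ⟨m, hm, hmin⟩ := hM.foundation z ⟨x, hz.left_mem⟩
  rcases (hz m).1 hm with rfl | rfl
  exacts [hmin y hyx hz.right_mem, hmin x hxy hz.left_mem]

theorem exists_orderedPair (x y : M) : ∃ p, IsOrderedPair p x y := by
  obtain ⟨a, ha⟩ := hM.pairing x x
  obtain ⟨b, hb⟩ := hM.pairing x y
  obtain ⟨p, hp⟩ := hM.pairing a b
  exact ⟨p, a, b, ha, hb, hp⟩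

theorem exists_prod (a b : M) :
    ∃ r, ∀ p, p ∊ r ↔ ∃ x y, x ∊ a ∧ y ∊ b ∧ IsOrderedPair p x y := by
  obtain ⟨c, hc⟩ := hM.exists_union a b
  obtain ⟨q, hq⟩ := hM.powerset c
  obtain ⟨r, hr⟩ := hM.powerset q
  obtain ⟨s, hs⟩ := hM.exists_separation
    (fun p => ∃ x y, x ∊ a ∧ y ∊ b ∧ IsOrderedPair p x y) r
  refine ⟨s, fun p => (hs p).trans (and_iff_right_of_imp ?_)⟩
  rintro ⟨x, y, hx, hy, s, t, hs, ht, hp⟩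
  refine (hr p).2 fun z hz => (hq z).2 fun w hw => (hc w).2 ?_
  rcases (hp z).1 hz with rfl | rfl
  · rcases (hs w).1 hw with rfl | rfl <;> exact Or.inl hx
  · rcases (ht w).1 hw with rfl | rfl
    exacts [Or.inl hx, Or.inr hy]

theorem exists_function (R : M → M → Prop) [hR : DefinablePred₂ R] (a b : M)
    (hab : ∀ x, x ∊ a → ∃! y, y ∊ b ∧ R x y) :
    ∃ f, IsFunction f a b ∧ ∀ x y, Maps f x y → R x y := by
  have {α : Type} (s t : (α → M) → M) [DefinableTerm s] [DefinableTerm t] :=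
    DefinablePred₂.comp hR s t
  obtain ⟨r, hr⟩ := hM.exists_prod a b
  obtain ⟨f, hf⟩ := hM.exists_separation (fun p => ∃ x y, R x y ∧ IsOrderedPair p x y) r
  have rel_of_maps (x y : M) (hxy : Maps f x y) : y ∊ b ∧ R x y := by
    obtain ⟨p, hp, hpf⟩ := hxy
    obtain ⟨hpr, x₁, y₁, hR, hp₁⟩ := (hf p).1 hpf
    obtain ⟨x₂, y₂, -, hy, hp₂⟩ := (hr p).1 hpr
    obtain ⟨rfl, rfl⟩ := hp.injective hp₁
    obtain ⟨rfl, rfl⟩ := hp.injective hp₂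
    exact ⟨hy, hR⟩
  refine ⟨f, ⟨fun p hp => (hr p).1 ((hf p).1 hp).1, fun x hx => ?_⟩,
    fun x y h => (rel_of_maps x y h).2⟩
  obtain ⟨y, ⟨hy, hxy⟩, huniq⟩ := hab x hx
  obtain ⟨p, hp⟩ := hM.exists_orderedPair x y
  exact ⟨y, ⟨p, hp, (hf p).2 ⟨(hr p).2 ⟨x, y, hx, hy, hp⟩, x, y, hxy, hp⟩⟩,
    fun z hz => huniq z (rel_of_maps x z hz)⟩

theorem cardLE_of_sub {a b : M} (h : Sub a b) : CardLE a b := by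
  obtain ⟨f, hf, hfR⟩ := hM.exists_function (fun x y => x = y) a b
    fun x hx => ⟨x, ⟨h x hx, rfl⟩, fun y hy => hy.2.symm⟩
  exact ⟨f, hf, fun x x' y hx hx' => (hfR x y hx).trans (hfR x' y hx').symm⟩

theorem cardLE_of_cardEq_symm {a b : M} (h : CardEq a b) : CardLE b a := by
  obtain ⟨f, hf, hinj, hsurj⟩ := h
  obtain ⟨g, hg, hgf⟩ := hM.exists_function (fun y x => Maps f x y) b a fun y hy => by
    obtain ⟨x, hx⟩ := hsurj y hy
    exact ⟨x, ⟨(hf.mem_of_maps hx).1, hx⟩, fun z hz => hinj z x y hz.2 hx⟩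
  exact ⟨g, hg, fun y y' x hy hy' => hf.maps_unique (hgf y x hy) (hgf y' x hy')⟩

theorem omega_induction (p : M → Prop) [DefinablePred₁ p] {w : M} (hw : IsOmega w)
    (zero : ∀ e, IsEmptySet e → p e)
    (succ : ∀ x s, x ∊ w → IsSucc s x → p x → p s) {n : M} (hn : n ∊ w) : p n := by
  obtain ⟨v, hv⟩ := hM.exists_separation p w
  suffices IsInductive v from ((hv n).1 (hw.2 v this n hn)).2
  refine ⟨?_, fun x hx => ?_⟩
  · obtain ⟨e, he, hew⟩ := hw.1.1
    exact ⟨e, he, (hv e).2 ⟨hew, zero e he⟩⟩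
  · obtain ⟨hxw, hpx⟩ := (hv x).1 hx
    obtain ⟨s, hs, hsw⟩ := hw.1.2 x hxw
    exact ⟨s, hs, (hv s).2 ⟨hsw, succ x s hxw hs hpx⟩⟩

theorem isSucc_injective {s x x' : M} (hx : IsSucc s x) (hx' : IsSucc s x') : x = x' := by
  rcases (hx x').1 ((hx' x').2 (Or.inr rfl)) with h | h
  · rcases (hx' x).1 ((hx x).2 (Or.inr rfl)) with h' | h'
    · exact (hM.not_mem_of_mem h h').elim
    · exact h'
  · exact h.symm

end IsModelZF

/-! ### Orbits of injections -/

/-- `y` is one of `x, h(x), h(h(x)), …`. Iterates are not available inside the model before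
recursion is developed, so this says that `y` lies in every set that contains `x` and is closed
under `h`. -/
def Reaches (h x y : M) : Prop :=
  ∀ s, x ∊ s → (∀ u v, u ∊ s → Maps h u v → v ∊ s) → y ∊ s

/-- `h` is an injection of `A` into `A ∖ {a}`, where `a ∈ A`: it witnesses that `A` is Dedekind
infinite. -/
structure IsShift (h A a : M) : Prop where
  isFunction : IsFunction h A A
  injective : ∀ x x' y, Maps h x y → Maps h x' y → x = x'
  base_mem : a ∊ A
  not_maps_base : ∀ x, ¬ Maps h x a

/-- All but finitely many points of the orbit `a, h(a), h(h(a)), …` of a shift satisfy `p`. -/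
def EventuallyAlong (h a : M) (p : M → Prop) : Prop :=
  ∃ x, Reaches h a x ∧ ∀ y, Reaches h x y → p y

instance DefinablePred.reaches {α : Type} (r s t : (α → M) → M) [DefinableTerm r]
    [DefinableTerm s] [DefinableTerm t] : DefinablePred fun v => Reaches (r v) (s v) (t v) := by
  unfold Reaches
  infer_instance

namespace Reaches

variable {h A a x y z : M}

theorem refl (h x : M) : Reaches h x x := fun _ hx _ => hx

theorem trans (hxy : Reaches h x y) (hyz : Reaches h y z) : Reaches h x z :=
  fun s hx hs => hyz s (hxy s hx hs) hs

theorem of_maps (hxy : Maps h x y) : Reaches h x y :=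
  fun _ hx hs => hs _ _ hx hxy

theorem mem (hh : IsFunction h A A) (hx : x ∊ A) (hxy : Reaches h x y) : y ∊ A :=
  hxy A hx fun _ _ _ huv => (hh.mem_of_maps huv).2

theorem induction (hM : IsModelZF M) (hh : IsFunction h A A) (p : M → Prop) [DefinablePred₁ p]
    (hxA : x ∊ A) (hx : p x) (step : ∀ u v, p u → Maps h u v → p v) (hxy : Reaches h x y) :
    p y := by
  obtain ⟨s, hs⟩ := hM.exists_separation p A
  refine ((hs y).1 (hxy s ((hs x).2 ⟨hxA, hx⟩) fun u v hu huv => (hs v).2 ⟨?_, ?_⟩)).2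
  · exact (hh.mem_of_maps huv).2
  · exact step u v ((hs u).1 hu).2 huv

theorem eq_or_of_maps (hM : IsModelZF M) (hh : IsFunction h A A) {x' : M} (hxx' : Maps h x x')
    (hxy : Reaches h x y) : y = x ∨ Reaches h x' y := by
  refine induction hM hh (fun y => y = x ∨ Reaches h x' y) (hh.mem_of_maps hxx').1
    (Or.inl rfl) ?_ hxy
  rintro u v (rfl | hu) huv
  · exact Or.inr (hh.maps_unique hxx' huv ▸ refl h x')
  · exact Or.inr (hu.trans (of_maps huv))

theorem total (hM : IsModelZF M) (hh : IsFunction h A A) (ha : a ∊ A) (hx : Reaches h a x)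
    (hy : Reaches h a y) : Reaches h x y ∨ Reaches h y x := by
  refine induction hM hh (fun y => Reaches h x y ∨ Reaches h y x) ha (Or.inr hx) ?_ hy
  rintro u v (hu | hu) huv
  · exact Or.inl (hu.trans (of_maps huv))
  · rcases eq_or_of_maps hM hh huv hu with rfl | hv
    exacts [Or.inl (of_maps huv), Or.inr hv]

end Reaches

namespace IsShift

variable {h A a : M} (hM : IsModelZF M) (hs : IsShift h A a)
include hM hs

theorem reaches_of_maps_maps {x y x' y' : M} (hx : Maps h x x') (hy : Maps h y y')
    (hxy : Reaches h x' y') : Reaches h x y := by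
  obtain ⟨z, hz, hxz⟩ : ∃ z, Maps h z y' ∧ Reaches h x z := by
    refine Reaches.induction hM hs.isFunction (fun w => ∃ z, Maps h z w ∧ Reaches h x z)
      (hs.isFunction.mem_of_maps hx).2 ⟨x, hx, Reaches.refl h x⟩ ?_ hxy
    rintro u v ⟨z, hz, hxz⟩ huv
    exact ⟨u, huv, hxz.trans (Reaches.of_maps hz)⟩
  exact hs.injective z y y' hz hy ▸ hxz

theorem not_reaches_base {x x' : M} (hxx' : Maps h x x') : ¬ Reaches h x' a := by
  intro hx'
  refine Reaches.induction hM hs.isFunction (fun y => y ≠ a) (hs.isFunction.mem_of_maps hxx').2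
    ?_ ?_ hx' rfl
  · rintro rfl
    exact hs.not_maps_base x hxx'
  · rintro u v - huv rfl
    exact hs.not_maps_base u huv

theorem not_reaches_of_maps {x x' : M} (hx : Reaches h a x) (hxx' : Maps h x x') :
    ¬ Reaches h x' x := by
  refine Reaches.induction hM hs.isFunction (fun x => ∀ x', Maps h x x' → ¬ Reaches h x' x)
    hs.base_mem (fun x' => hs.not_reaches_base hM) ?_ hx x' hxx'
  intro u v hu huv v' hvv' hv'v
  exact hu v huv (hs.reaches_of_maps_maps hM hvv' huv hv'v)

theorem reaches_antisymm {x y : M} (hx : Reaches h a x) (hxy : Reaches h x y)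
    (hyx : Reaches h y x) : x = y := by
  obtain ⟨x', hx', -⟩ := hs.isFunction.2 x (hx.mem hs.isFunction hs.base_mem)
  rcases hxy.eq_or_of_maps hM hs.isFunction hx' with rfl | hx'y
  · rfl
  · exact (hs.not_reaches_of_maps hM hx hx' (hx'y.trans hyx)).elim

theorem eventuallyAlong_and {p q : M → Prop} (hp : EventuallyAlong h a p)
    (hq : EventuallyAlong h a q) : EventuallyAlong h a fun x => p x ∧ q x := by
  obtain ⟨x, hx, hpx⟩ := hp
  obtain ⟨y, hy, hqy⟩ := hq
  rcases hx.total hM hs.isFunction hs.base_mem hy with hxy | hyx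
  · exact ⟨y, hy, fun z hz => ⟨hpx z (hxy.trans hz), hqy z hz⟩⟩
  · exact ⟨x, hx, fun z hz => ⟨hpx z hz, hqy z (hyx.trans hz)⟩⟩

theorem eventuallyAlong_ne (b : M) : EventuallyAlong h a (· ≠ b) := by
  by_cases hb : Reaches h a b
  · obtain ⟨b', hb', -⟩ := hs.isFunction.2 b (hb.mem hs.isFunction hs.base_mem)
    refine ⟨b', hb.trans (Reaches.of_maps hb'), ?_⟩
    rintro y hy rfl
    exact hs.not_reaches_of_maps hM hb hb' hy
  · refine ⟨a, Reaches.refl h a, ?_⟩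
    rintro y hy rfl
    exact hb hy

theorem eventuallyAlong_forall_mem {S : M} (hS : IsFinite S) (q : M → M → Prop)
    [hq : DefinablePred₂ q] (h_each : ∀ s, s ∊ S → EventuallyAlong h a (q s)) :
    EventuallyAlong h a fun y => ∀ s, s ∊ S → q s y := by
  have {α : Type} (s t : (α → M) → M) [DefinableTerm s] [DefinableTerm t] :=
    DefinablePred₂.comp hq s t
  obtain ⟨w, n, hw, hn, f, hf, hinj, -⟩ := hS
  have h_below : ∃ x, Reaches h a x ∧ ∀ y, Reaches h x y →
      ∀ s i, s ∊ S → i ∊ n → Maps f s i → q s y := by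
    refine hM.omega_induction (fun k => ∃ x, Reaches h a x ∧ ∀ y, Reaches h x y →
      ∀ s i, s ∊ S → i ∊ k → Maps f s i → q s y) hw ?_ ?_ hn
    · intro e he
      exact ⟨a, Reaches.refl h a, fun _ _ _ i _ hi => (he i hi).elim⟩
    · intro k k' _ hk' ih
      have h_last : EventuallyAlong h a fun y => ∀ s, s ∊ S → Maps f s k → q s y := by
        by_cases hk : ∃ s, s ∊ S ∧ Maps f s k
        · obtain ⟨s, hsS, hsk⟩ := hk
          obtain ⟨x, hx, hqx⟩ := h_each s hsS
          exact ⟨x, hx, fun y hy s' _ hs'k => hinj s s' k hsk hs'k ▸ hqx y hy⟩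
        · exact ⟨a, Reaches.refl h a, fun _ _ s hsS hsk => (hk ⟨s, hsS, hsk⟩).elim⟩
      obtain ⟨x, hx, hqx⟩ := hs.eventuallyAlong_and hM ih h_last
      refine ⟨x, hx, fun y hy s i hsS hi hsi => ?_⟩
      rcases (hk' i).1 hi with hik | rfl
      exacts [(hqx y hy).1 s i hsS hik hsi, (hqx y hy).2 s hsS hsi]
  obtain ⟨x, hx, hqx⟩ := h_below
  refine ⟨x, hx, fun y hy s hsS => ?_⟩
  obtain ⟨i, hsi, -⟩ := hf.2 s hsS
  exact hqx y hy s i hsS (hf.mem_of_maps hsi).2 hsi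

theorem not_isFinite_of_cover {S : M} (R : M → M → Prop) [hR : DefinablePred₂ R]
    (cover : ∀ y, Reaches h a y → ∃ s, s ∊ S ∧ R s y)
    (eventually_not : ∀ s, s ∊ S → EventuallyAlong h a fun y => ¬ R s y) : ¬ IsFinite S := by
  intro hS
  obtain ⟨x, hx, hxR⟩ := hs.eventuallyAlong_forall_mem hM hS (fun s y => ¬ R s y) eventually_not
  obtain ⟨s, hsS, hsx⟩ := cover x hx
  exact hxR x (Reaches.refl h x) s hsS hsx

end IsShift

theorem IsModelZF.exists_isShift_omega (hM : IsModelZF M) {w : M} (hw : IsOmega w) :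
    ∃ h e, IsShift h w e := by
  obtain ⟨e, he, hew⟩ := hw.1.1
  obtain ⟨h, hh, h_succ⟩ := hM.exists_function (fun x s => IsSucc s x) w w fun x hx => by
    obtain ⟨s, hs, hsw⟩ := hw.1.2 x hx
    exact ⟨s, ⟨hsw, hs⟩, fun t ht =>
      hM.extensionality t s fun z => (ht.2 z).trans (hs z).symm⟩
  exact ⟨h, e, hh,
    fun x x' y hx hx' => hM.isSucc_injective (h_succ x y hx) (h_succ x' y hx'), hew,
    fun x hx => he x ((h_succ x e hx x).2 (Or.inr rfl))⟩

theorem CardLE.exists_isShift {A B a : M} (hAB : CardLE A B) (hBA : Sub B A) (haA : a ∊ A)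
    (haB : ¬ a ∊ B) : ∃ h, IsShift h A a ∧ IsFunction h A B := by
  obtain ⟨h, hh, hinj⟩ := hAB
  exact ⟨h, ⟨hh.mono hBA, hinj, haA, fun x hx => haB (hh.mem_of_maps hx).2⟩, hh⟩

/-! ### Partitions into pairs and their colourings -/

/-- `E` is a partition of `X` into two-element sets. -/
structure IsPairPartition (X E : M) : Prop where
  pair : ∀ e, e ∊ E → ∃ x y, x ≠ y ∧ IsUnorderedPair e x y
  disjoint : ∀ e e' x, e ∊ E → e' ∊ E → x ∊ e → x ∊ e' → e = e'
  cover : ∀ x, x ∊ X ↔ ∃ e, e ∊ E ∧ x ∊ e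

/-- `E` is an infinite partition of `X` into pairs, and no infinite subset of `E` has a choice
function. This is the notion of a Russell set without the enumeration of the pairs. -/
structure IsRussellPartition (X E : M) : Prop extends IsPairPartition X E where
  not_isFinite : ¬ IsFinite E
  no_choice : ∀ S, Sub S E → ¬ IsFinite S → ¬ HasChoiceFunction S

theorem IsRussellSet.isRussellPartition (hM : IsModelZF M) {X P E : M} (hX : IsRussellSet X P)
    (hE : IsSetOfTerms E P) : IsRussellPartition X E := by
  obtain ⟨w, Q, hw, hP⟩ := hX.sequence
  refine ⟨⟨?pair, ?disjoint, ?cover⟩, ?not_isFinite, ?no_choice⟩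
  case pair =>
    intro e he
    obtain ⟨n, hn⟩ := (hE e).1 he
    exact hX.pair n e hn
  case disjoint =>
    intro e e' x he he' hx hx'
    obtain ⟨n, hn⟩ := (hE e).1 he
    obtain ⟨m, hm⟩ := (hE e').1 he'
    obtain rfl : n = m := by
      by_contra hnm
      exact hX.disjoint n m e e' hn hm hnm x ⟨hx, hx'⟩
    exact hP.maps_unique hn hm
  case cover =>
    exact fun x => (hX.cover x).trans (exists_comm.trans (exists_congr fun e => by
      rw [hE e, exists_and_right]))
  case not_isFinite =>
    obtain ⟨h, z, hs⟩ := hM.exists_isShift_omega hw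
    refine hs.not_isFinite_of_cover hM (fun e n => Maps P n e) (fun n hn => ?_) fun e he => ?_
    · obtain ⟨e, he, -⟩ := hP.2 n (hn.mem hs.isFunction hs.base_mem)
      exact ⟨e, (hE e).2 ⟨n, he⟩, he⟩
    · obtain ⟨n, hn⟩ := (hE e).1 he
      obtain ⟨x, y, -, hxy⟩ := hX.pair n e hn
      obtain ⟨k, hk, hne⟩ := hs.eventuallyAlong_ne hM n
      exact ⟨k, hk, fun m hm hme =>
        hX.disjoint m n e e hme hn (hne m hm) x ⟨hxy.left_mem, hxy.left_mem⟩⟩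
  case no_choice =>
    exact fun S hS => hX.no_choice S fun p hp => (hE p).1 (hS p hp)

/-- The colouring `c` gives the colour `a` to one of the vertices of the edge that contains `u`. -/
def EdgeHasColor (E c a u : M) : Prop := ∃ e v, e ∊ E ∧ u ∊ e ∧ v ∊ e ∧ Maps c v a

/-- `x` is the colour of `u` in the colouring obtained from `c` by recolouring each edge on which
`a` occurs, using `b₁` in place of `a` and `b₂` for the other vertex. -/
def Recolors (E c a b₁ b₂ u x : M) : Prop :=
  Maps c u a ∧ x = b₁ ∨
    EdgeHasColor E c a u ∧ ¬ Maps c u a ∧ x = b₂ ∨ ¬ EdgeHasColor E c a u ∧ Maps c u x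

/-- On the edge `e`, the vertex `u` has the colour that comes first in the orbit of `a` under `h`.
This singles out a vertex of each edge on which the orbit occurs. -/
def HasFirstColor (h a c e u : M) : Prop :=
  ∃ x, Maps c u x ∧ Reaches h a x ∧
    ∀ v y, v ∊ e → Maps c v y → Reaches h a y → Reaches h x y

namespace IsPairPartition

variable {X E A c : M} (hX : IsPairPartition X E) (hc : IsProperColoring X E A c)
include hX hc

theorem exists_color {e u : M} (he : e ∊ E) (hu : u ∊ e) : ∃ a, Maps c u a :=
  (hc.1.2 u ((hX.cover u).2 ⟨e, he, hu⟩)).exists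

theorem eq_of_color_eq {e u v a : M} (he : e ∊ E) (hu : u ∊ e) (hv : v ∊ e) (hua : Maps c u a)
    (hva : Maps c v a) : u = v := by
  by_contra huv
  obtain ⟨x, y, -, hxy⟩ := hX.pair e he
  exact hc.2 e u v he (hxy.of_mem_of_ne hu hv huv) a a hua hva rfl

omit hc in
theorem edgeHasColor_iff {e u v a : M} (he : e ∊ E) (huv : IsUnorderedPair e u v) {t : M}
    (ht : t ∊ e) : EdgeHasColor E c a t ↔ Maps c u a ∨ Maps c v a := by
  constructor
  · rintro ⟨e', s, he', ht', hs, hsa⟩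
    obtain rfl := hX.disjoint e e' t he he' ht ht'
    rcases (huv s).1 hs with rfl | rfl
    exacts [Or.inl hsa, Or.inr hsa]
  · rintro (h | h)
    exacts [⟨e, u, he, ht, huv.left_mem, h⟩, ⟨e, v, he, ht, huv.right_mem, h⟩]

theorem existsUnique_recolors {B a b₁ b₂ : M} (hB : ∀ u x, Maps c u x → x ≠ a → x ∊ B)
    (hb₁ : b₁ ∊ B) (hb₂ : b₂ ∊ B) {u : M} (hu : u ∊ X) :
    ∃! x, x ∊ B ∧ Recolors E c a b₁ b₂ u x := by
  obtain ⟨e, he, hue⟩ := (hX.cover u).1 hu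
  have edgeHasColor_of_maps (hua : Maps c u a) : EdgeHasColor E c a u :=
    ⟨e, u, he, hue, hue, hua⟩
  obtain ⟨x, hx, hx_unique⟩ := hc.1.2 u hu
  have hxB := hB u x hx
  unfold Recolors
  by_cases hua : Maps c u a
  · exact ⟨b₁, by tauto, by tauto⟩
  by_cases hea : EdgeHasColor E c a u
  · exact ⟨b₂, by tauto, by tauto⟩
  · refine ⟨x, ⟨hxB ?_, Or.inr (Or.inr ⟨hea, hx⟩)⟩, fun y hy => hx_unique y (by tauto)⟩
    rintro rfl
    exact hua hx

theorem recolors_ne {e u v a b₁ b₂ x y : M} (hb : b₁ ≠ b₂) (he : e ∊ E)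
    (huv : IsUnorderedPair e u v) (hx : Recolors E c a b₁ b₂ u x)
    (hy : Recolors E c a b₁ b₂ v y) : x ≠ y := by
  have h_proper := hc.2 e u v he huv
  have h_not_both : ¬ (Maps c u a ∧ Maps c v a) := fun h => h_proper a a h.1 h.2 rfl
  rw [Recolors, hX.edgeHasColor_iff he huv huv.left_mem] at hx
  rw [Recolors, hX.edgeHasColor_iff he huv huv.right_mem] at hy
  grind

theorem colorable_of_omit_color (hM : IsModelZF M) {B a b₁ b₂ : M}
    (hB : ∀ u x, Maps c u x → x ≠ a → x ∊ B) (hb₁ : b₁ ∊ B) (hb₂ : b₂ ∊ B) (hb : b₁ ≠ b₂) :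
    Colorable X E B := by
  have : DefinablePred₂ (Recolors E c a b₁ b₂) := by
    unfold Recolors EdgeHasColor
    infer_instance
  obtain ⟨d, hd, hdR⟩ := hM.exists_function (Recolors E c a b₁ b₂) X B fun u hu =>
    hX.existsUnique_recolors hc hB hb₁ hb₂ hu
  exact ⟨d, hd, fun e u v he huv x y hx hy =>
    hX.recolors_ne hc hb he huv (hdR u x hx) (hdR v y hy)⟩

variable (hM : IsModelZF M) {C h a : M} (hs : IsShift h C a)
include hM hs

theorem existsUnique_hasFirstColor {e u x : M} (he : e ∊ E) (hu : u ∊ e) (hux : Maps c u x)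
    (hx : Reaches h a x) : ∃! v, v ∊ e ∧ HasFirstColor h a c e v := by
  refine existsUnique_of_exists_of_unique ?_ ?_
  · by_cases h_first : HasFirstColor h a c e u
    · exact ⟨u, hu, h_first⟩
    obtain ⟨v, y, hv, hvy, hy, hxy⟩ : ∃ v y, v ∊ e ∧ Maps c v y ∧ Reaches h a y ∧
        ¬ Reaches h x y := by
      by_contra! h_all
      exact h_first ⟨x, hux, hx, h_all⟩
    have hyx := (hx.total hM hs.isFunction hs.base_mem hy).resolve_left hxy
    have huv : u ≠ v := by
      rintro rfl
      exact hxy (hc.1.maps_unique hux hvy ▸ Reaches.refl h x)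
    obtain ⟨u', v', -, he'⟩ := hX.pair e he
    refine ⟨v, hv, y, hvy, hy, fun t z ht htz _ => ?_⟩
    rcases (he'.of_mem_of_ne hu hv huv t).1 ht with rfl | rfl
    · exact hc.1.maps_unique hux htz ▸ hyx
    · exact hc.1.maps_unique hvy htz ▸ Reaches.refl h y
  · rintro v v' ⟨hv, y, hvy, hy, hmin⟩ ⟨hv', y', hvy', hy', hmin'⟩
    obtain rfl := hs.reaches_antisymm hM hy (hmin v' y' hv' hvy' hy') (hmin' v y hv hvy hy)
    exact hX.eq_of_color_eq hc he hv hv' hvy hvy'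

theorem eventuallyAlong_not_color {e : M} (he : e ∊ E) :
    EventuallyAlong h a fun y => ¬ ∃ u, u ∊ e ∧ Maps c u y := by
  obtain ⟨u, v, -, huv⟩ := hX.pair e he
  obtain ⟨x, hux⟩ := hX.exists_color hc he huv.left_mem
  obtain ⟨y, hvy⟩ := hX.exists_color hc he huv.right_mem
  obtain ⟨k, hk, hne⟩ := hs.eventuallyAlong_and hM (hs.eventuallyAlong_ne hM x)
    (hs.eventuallyAlong_ne hM y)
  refine ⟨k, hk, ?_⟩
  rintro z hz ⟨t, ht, htz⟩
  rcases (huv t).1 ht with rfl | rfl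
  exacts [(hne z hz).1 (hc.1.maps_unique htz hux), (hne z hz).2 (hc.1.maps_unique htz hvy)]

end IsPairPartition

/-! ### Russell partitions have no least set of colours -/

namespace IsRussellPartition

variable (hM : IsModelZF M) {X E : M} (hX : IsRussellPartition X E)
include hM hX

theorem isFinite_of_existsUnique {S : M} (hS : Sub S E) (R : M → M → Prop)
    [hR : DefinablePred₂ R] (h_unique : ∀ e, e ∊ S → ∃! u, u ∊ e ∧ R e u) : IsFinite S := by
  have {α : Type} (s t : (α → M) → M) [DefinableTerm s] [DefinableTerm t] :=
    DefinablePred₂.comp hR s t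
  by_contra hS_inf
  obtain ⟨f, hf, hfR⟩ := hM.exists_function (fun e u => u ∊ e ∧ R e u) S X fun e he => by
    obtain ⟨u, hu, hu_unique⟩ := h_unique e he
    exact ⟨u, ⟨(hX.cover u).2 ⟨e, hS e he, hu.1⟩, hu⟩, fun v hv => hu_unique v hv.2⟩
  exact hX.no_choice S hS hS_inf ⟨f, X, hf, fun e u _ heu => (hfR e u heu).1⟩

variable {A c : M} (hc : IsProperColoring X E A c)
include hc

theorem exists_color_ne_ne (a b : M) : ∃ u x, Maps c u x ∧ x ≠ a ∧ x ≠ b := by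
  by_contra! h_two
  refine hX.not_isFinite (hX.isFinite_of_existsUnique hM (fun _ he => he)
    (fun _ u => Maps c u a) fun e he => ?_)
  obtain ⟨u, v, -, huv⟩ := hX.pair e he
  obtain ⟨x, hux⟩ := hX.exists_color hc he huv.left_mem
  obtain ⟨y, hvy⟩ := hX.exists_color hc he huv.right_mem
  have hxy : x ≠ y := hc.2 e u v he huv x y hux hvy
  refine existsUnique_of_exists_of_unique ?_
    fun t t' ht ht' => hX.eq_of_color_eq hc he ht.1 ht'.1 ht.2 ht'.2
  by_cases hxa : x = a
  · exact ⟨u, huv.left_mem, hxa ▸ hux⟩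
  · have hya : y = a := by
      by_contra hya
      exact hxy ((h_two u x hux hxa).trans (h_two v y hvy hya).symm)
    exact ⟨v, huv.right_mem, hya ▸ hvy⟩

theorem exists_reaches_not_color {C h a : M} (hs : IsShift h C a) :
    ∃ x, Reaches h a x ∧ ∀ u, ¬ Maps c u x := by
  by_contra! h_used
  obtain ⟨S, hS⟩ := hM.exists_separation (fun e => ∃ u x, u ∊ e ∧ Maps c u x ∧ Reaches h a x) E
  refine hs.not_isFinite_of_cover (S := S) hM (fun e y => ∃ u, u ∊ e ∧ Maps c u y)
    (fun x hx => ?_)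
    (fun e he => hX.eventuallyAlong_not_color hc hM hs ((hS e).1 he).1) ?_
  · obtain ⟨u, hux⟩ := h_used x hx
    obtain ⟨e, he, hue⟩ := (hX.cover u).1 (hc.1.mem_of_maps hux).1
    exact ⟨e, (hS e).2 ⟨he, u, x, hue, hux, hx⟩, u, hue, hux⟩
  · have : DefinablePred₂ (HasFirstColor h a c) := by
      unfold HasFirstColor
      infer_instance
    refine hX.isFinite_of_existsUnique hM (fun e he => ((hS e).1 he).1)
      (HasFirstColor h a c) fun e he => ?_
    obtain ⟨heE, u, x, hu, hux, hx⟩ := (hS e).1 he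
    exact hX.existsUnique_hasFirstColor hc hM hs heE hu hux hx

theorem not_cardLE_of_omit_color {B a u : M} (hua : Maps c u a)
    (hB : ∀ x, x ∊ B ↔ x ∊ A ∧ x ≠ a ∧ ∃ v, Maps c v x) : ¬ CardLE A B := by
  intro hAB
  obtain ⟨h, hs, hAB⟩ := hAB.exists_isShift (fun x hx => ((hB x).1 hx).1)
    (hc.1.mem_of_maps hua).2 fun ha => ((hB a).1 ha).2.1 rfl
  obtain ⟨x, hx, hx_unused⟩ := hX.exists_reaches_not_color hM hc hs
  obtain ⟨v, hv⟩ : ∃ v, Maps c v x :=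
    hx.induction hM hs.isFunction (fun x => ∃ v, Maps c v x) hs.base_mem ⟨u, hua⟩
      fun y z _ hyz => ((hB z).1 (hAB.mem_of_maps hyz).2).2.2
  exact hx_unused v hv

theorem exists_colorable_sub_not_cardLE : ∃ B, Colorable X E B ∧ Sub B A ∧ ¬ CardLE A B := by
  obtain ⟨u, a, hua, -⟩ := hX.exists_color_ne_ne hM hc A A
  obtain ⟨v, b₁, hvb₁, hb₁, -⟩ := hX.exists_color_ne_ne hM hc a a
  obtain ⟨w, b₂, hwb₂, hb₂, hb₂₁⟩ := hX.exists_color_ne_ne hM hc a b₁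
  obtain ⟨B, hB⟩ := hM.exists_separation (fun x => x ≠ a ∧ ∃ v, Maps c v x) A
  have mem_of_maps (v x : M) (hvx : Maps c v x) (hxa : x ≠ a) : x ∊ B :=
    (hB x).2 ⟨(hc.1.mem_of_maps hvx).2, hxa, v, hvx⟩
  exact ⟨B,
    hX.colorable_of_omit_color hc hM mem_of_maps (mem_of_maps v b₁ hvb₁ hb₁)
      (mem_of_maps w b₂ hwb₂ hb₂) hb₂₁.symm,
    fun x hx => ((hB x).1 hx).1, hX.not_cardLE_of_omit_color hM hc hua hB⟩

end IsRussellPartition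

end ZFModel

open ZFModel in
theorem mainTheorem12_general {M : Type*} [setLang.Structure M] (hM : IsModelZF M) (X E : M)
    (hX : IsRussellPartition X E) :
    (¬ ∃ A, IsChromaticNumber X E A) ∧
      ∀ A c, IsProperColoring X E A c →
        ∃ B d, IsProperColoring X E B d ∧ CardLT B A := by
  constructor
  · rintro ⟨A, ⟨c, hc⟩, h_least⟩
    obtain ⟨B, hB, -, hAB⟩ := hX.exists_colorable_sub_not_cardLE hM hc
    exact hAB (h_least B hB)
  · intro A c hc
    obtain ⟨B, ⟨d, hd⟩, hBA, hAB⟩ := hX.exists_colorable_sub_not_cardLE hM hc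
    exact ⟨B, d, hd, hM.cardLE_of_sub hBA, fun h => hAB (hM.cardLE_of_cardEq_symm h)⟩

open ZFModel in
theorem mainTheorem12 {M : Type*} [setLang.Structure M] (hM : IsModelZF M)
    (X P E : M) (hX : IsRussellSet X P) (hE : IsSetOfTerms E P) :
    (¬ ∃ A, IsChromaticNumber X E A) ∧
      ∀ A c, IsProperColoring X E A c →
        ∃ B d, IsProperColoring X E B d ∧ CardLT B A :=
  mainTheorem12_general hM X E (hX.isRussellPartition hM hE)
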